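/- Let $G$ be a finite group with centre $Z=\mathrm{Z}(G)$, let $\mathrm{Irr}(G)$ be the set of irreducible complex characters of $G$, let $\ker\psi=\{x\in G:\psi(x)=\psi(1)\}$ for $\psi\in\mathrm{Irr}(G)$, let $g^G$ be the conjugacy class of $g\in G$, and regard $\mathrm{Irr}(G/Z)$ as a subset of $\mathrm{Irr}(G)$ by inflation. Let $\chi\in\mathrm{Irr}(G)$ be nonlinear, that is, $\chi(1)\neq 1$. Then the following are equivalent: (1) There is $g\in G\setminus Z$ such that $\chi(g)\neq 0$ and $\chi$ vanishes on every noncentral conjugacy class of $G$ other than $g^G$. (2) $Z\le\ker\chi$, and there is $g\in G\setminus Z$ such that for every $\psi\in\mathrm{Irr}(G)$ with $\psi\neq\chi$: if $\psi\in\mathrm{Irr}(G/Z)$ then $g\in\ker\psi$, and if $\psi\notin\mathrm{Irr}(G/Z)$ then $\psi(g)=0$. Furthermore, if (1) or (2) holds, then for every element $g$ as in (1) and every element $g$ as in (2): - $Z=\ker\chi<G'$ (proper inclusion), where $G'$ is the derived subgroup of $G$; - $\chi(g)=-|Z|\,\chi(1)/|g^G|$, and this is an integer; - $|\mathrm{C}_G(g)|=|\mathrm{C}_{G/Z}(gZ)|$,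 and there is a prime $p$ such that $|\mathrm{C}_G(g)|$ is a power of $p$ and $Z$ is a $p$-group; - $G/Z$ has a unique minimal normal subgroup $M/Z$, and $M\setminus Z$ is a single conjugacy class of $G$. -/

import Mathlib

/-- `Irr G`: the irreducible complex characters of `G`, as functions on `G`. A finite-dimensional
complex representation is given, up to isomorphism, by one on some `ℂⁿ`. -/
def Irr (G : Type*) [Group G] : Set (G → ℂ) :=
  {χ | ∃ (n : ℕ) (ρ : Representation ℂ G (Fin n → ℂ)), ρ.IsIrreducible ∧ ρ.character = χ}

/-- The kernel of a character: `ker χ = {x ∈ G : χ(x) = χ(1)}`. -/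
def charKer {G : Type*} [Group G] (χ : G → ℂ) : Set G :=
  {x | χ x = χ 1}

/-- `Irr(G/N)` viewed as a set of characters of `G`: the inflations to `G` of the irreducible
characters of the quotient group `G ⧸ N`. -/
def inflatedIrr {G : Type*} [Group G] (N : Subgroup G) [N.Normal] : Set (G → ℂ) :=
  {ψ | ∃ φ ∈ Irr (G ⧸ N), ψ = fun x : G => φ (x : G ⧸ N)}

/-- `g` is noncentral, and among the noncentral conjugacy classes of `G`, the class of `g` is the
only one on which `χ` does not vanish. -/
def VanishesOnNoncentralExcept {G : Type*} [Group G] (χ : G → ℂ) (g : G) : Prop :=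
  g ∉ Subgroup.center G ∧ χ g ≠ 0 ∧
    ∀ x : G, x ∉ Subgroup.center G → ¬ IsConj g x → χ x = 0

/-- `g` is noncentral, and every irreducible character `ψ ≠ χ` of `G` has `g` in its kernel if
`ψ ∈ Irr(G/Z(G))`, and vanishes at `g` otherwise. -/
def OthersTrivialOrVanishAt {G : Type*} [Group G] (χ : G → ℂ) (g : G) : Prop :=
  g ∉ Subgroup.center G ∧
    ∀ ψ ∈ Irr G, ψ ≠ χ →
      (ψ ∈ inflatedIrr (Subgroup.center G) → g ∈ charKer ψ) ∧
      (ψ ∉ inflatedIrr (Subgroup.center G) → ψ g = 0)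

/-- `N` is a minimal normal subgroup: minimal among the nontrivial normal subgroups. -/
def IsMinimalNormal {H : Type*} [Group H] (N : Subgroup H) : Prop :=
  Minimal (fun K : Subgroup H => K.Normal ∧ K ≠ ⊥) N

/-- `N` is the unique minimal normal subgroup of `H`. -/
def IsUniqueMinimalNormal {H : Type*} [Group H] (N : Subgroup H) : Prop :=
  IsMinimalNormal N ∧ ∀ K : Subgroup H, IsMinimalNormal K → K = N

/-! Write Z for the centre and k for |g^G|. If χ is supported on Z ∪ g^G, comparing χ(g) with χ(zg)
shows that g^G is a union of Z-cosets and that Z acts trivially in χ. The inner product of χ with ψ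
then has two terms: χ(1) times the sum of conj ψ over Z, which is |Z|ψ(1) or 0 according as ψ is
inflated from G/Z or not, and kχ(g) times conj ψ(g). The trivial character gives |Z|χ(1) + kχ(g) =
0, and every other ψ ≠ χ then gives (2). Conversely, (2) makes the class function |Z|·1_{g^G} −
k·1_Z orthogonal to every ψ ≠ χ, so it is a multiple of χ.

For the consequences, χ(g) is a rational algebraic integer, χ(g) = −m with m > 0. The intersection
of the kernels of all ψ ≠ χ in Irr(G/Z) turns out to be M = Z ∪ g^G, so the nontrivial elements of
M/Z form one class and M/Z has prime exponent p. With κ the size of the class of gZ and d = χ(1),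
orthogonality and the norm of χ give d = κm, |G/Z| = dm(κ+1) and |C_G(g)| = m²(κ+1), where κ+1 =
|M/Z|. For a prime r ≠ p, χ vanishes on the nontrivial elements of a Sylow r-subgroup of G/Z, whose
order therefore divides d; as dm divides |G/Z|, r cannot divide m. Hence |C_G(g)| is a power of p,
and Z ≤ C_G(g). -/

open scoped MonoidAlgebra

/-! ### Irreducible representations, Schur's lemma, and eigenvalues as roots of unity. -/

namespace Representation

variable {G V : Type*} [Group G] [AddCommGroup V] [Module ℂ V]

theorem isIrreducible_iff_forall_invariant (ρ : Representation ℂ G V) :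
    ρ.IsIrreducible ↔ Nontrivial V ∧
      ∀ U : Submodule ℂ V, (∀ g, ∀ v ∈ U, ρ g v ∈ U) → U = ⊥ ∨ U = ⊤ := by
  constructor
  · intro h
    refine ⟨?_, fun U hU => ?_⟩
    · by_contra hV
      rw [not_nontrivial_iff_subsingleton] at hV
      obtain ⟨a, b, hab⟩ := h.toNontrivial
      refine hab (SetLike.ext fun x => ?_)
      rw [Subsingleton.elim x 0]
      exact iff_of_true (zero_mem a.toSubmodule) (zero_mem b.toSubmodule)
    · rcases h.eq_bot_or_eq_top (⟨U, fun g v hv => hU g v hv⟩ : Subrepresentation ρ) with h | h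
      · exact Or.inl (congrArg Subrepresentation.toSubmodule h)
      · exact Or.inr (congrArg Subrepresentation.toSubmodule h)
  · rintro ⟨hV, h⟩
    have hne : (⊥ : Subrepresentation ρ) ≠ ⊤ := fun e =>
      bot_ne_top (α := Submodule ℂ V) (congrArg Subrepresentation.toSubmodule e)
    refine { exists_pair_ne := ⟨⊥, ⊤, hne⟩, eq_bot_or_eq_top := fun U => ?_ }
    rcases h U.toSubmodule (fun g v hv => U.apply_mem_toSubmodule g hv) with h | h
    · exact Or.inl (Subrepresentation.toSubmodule_injective h)
    · exact Or.inr (Subrepresentation.toSubmodule_injective h)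

theorem IsIrreducible.nontrivial {ρ : Representation ℂ G V} (h : ρ.IsIrreducible) : Nontrivial V :=
  ((isIrreducible_iff_forall_invariant ρ).1 h).1

/-- Schur's lemma. -/
theorem IsIrreducible.exists_eq_smul_one [FiniteDimensional ℂ V] {ρ : Representation ℂ G V}
    (h : ρ.IsIrreducible) (A : Module.End ℂ V) (hA : ∀ g, Commute A (ρ g)) :
    ∃ c : ℂ, A = c • 1 := by
  obtain ⟨hV, h⟩ := (isIrreducible_iff_forall_invariant ρ).1 h
  obtain ⟨c, hc⟩ := Module.End.exists_eigenvalue A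
  refine ⟨c, ?_⟩
  have hinv : ∀ g, ∀ v ∈ A.eigenspace c, ρ g v ∈ A.eigenspace c := by
    intro g v hv
    rw [Module.End.mem_eigenspace_iff] at hv ⊢
    have := LinearMap.congr_fun (hA g).eq v
    simp only [Module.End.mul_apply] at this
    rw [this, hv, map_smul]
  rcases h (A.eigenspace c) hinv with h | h
  · exact absurd h hc
  · ext v
    have : v ∈ A.eigenspace c := h ▸ Submodule.mem_top
    simpa using Module.End.mem_eigenspace_iff.1 this

/-- `Irr` only admits representations on `Fin n → ℂ`; conjugating by a basis brings any other space
into that form. -/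
theorem character_mem_Irr [FiniteDimensional ℂ V] (ρ : Representation ℂ G V)
    (h : ρ.IsIrreducible) : ρ.character ∈ Irr G := by
  obtain ⟨hV, h⟩ := (isIrreducible_iff_forall_invariant ρ).1 h
  let e : V ≃ₗ[ℂ] (Fin (Module.finrank ℂ V) → ℂ) := (Module.finBasis ℂ V).equivFun
  let σ : Representation ℂ G (Fin (Module.finrank ℂ V) → ℂ) :=
    { toFun := fun g => e.conj (ρ g)
      map_one' := by simp [Module.End.one_eq_id]
      map_mul' := fun a b => by simp [Module.End.mul_eq_comp, LinearEquiv.conj_comp] }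
  have hσ : ∀ g, σ g = e.conj (ρ g) := fun _ => rfl
  refine ⟨_, σ, (isIrreducible_iff_forall_invariant σ).2 ⟨e.symm.toEquiv.nontrivial, ?_⟩, ?_⟩
  · intro U hU
    have hinv : ∀ g, ∀ v ∈ U.comap (e : V →ₗ[ℂ] _), ρ g v ∈ U.comap (e : V →ₗ[ℂ] _) := by
      intro g v hv
      have := hU g (e v) hv
      simpa [hσ, LinearEquiv.conj_apply] using this
    rcases h (U.comap (e : V →ₗ[ℂ] _)) hinv with h | h
    · left
      rw [eq_bot_iff]
      intro u hu
      have : e.symm u ∈ U.comap (e : V →ₗ[ℂ] _) := by simpa using hu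
      rw [h, Submodule.mem_bot] at this
      simpa using this
    · right
      rw [eq_top_iff]
      intro u _
      have : e.symm u ∈ U.comap (e : V →ₗ[ℂ] _) := h ▸ Submodule.mem_top
      simpa using this
  · ext g
    simp [character, hσ]

section Eigenspaces

variable (ρ : Representation ℂ G V)

theorem pow_natCard_eq_one (x : G) : ρ x ^ Nat.card G = 1 := by
  rw [← map_pow, pow_card_eq_one', map_one]

theorem pow_natCard_eq_one_of_eigenspace_ne_bot {x : G} {μ : ℂ}
    (h : Module.End.eigenspace (ρ x) μ ≠ ⊥) : μ ^ Nat.card G = 1 := by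
  obtain ⟨v, hv, hv0⟩ := Submodule.exists_mem_ne_zero_of_ne_bot h
  rw [Module.End.mem_eigenspace_iff] at hv
  have h2 : ∀ n : ℕ, (ρ x ^ n) v = μ ^ n • v := by
    intro n
    induction n with
    | zero => simp
    | succ n ih => rw [pow_succ', Module.End.mul_apply, ih, map_smul, hv, smul_smul, pow_succ]
  have h3 := h2 (Nat.card G)
  rw [pow_natCard_eq_one, Module.End.one_apply] at h3
  have : (μ ^ Nat.card G - 1) • v = 0 := by rw [sub_smul, ← h3, one_smul, sub_self]
  rcases smul_eq_zero.1 this with h | h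
  · exact sub_eq_zero.1 h
  · exact absurd h hv0

variable [Finite G] [FiniteDimensional ℂ V]

/-- `ρ x` is a root of X^|G| − 1, which is squarefree over ℂ, so `ρ x` is diagonalizable. -/
theorem iSup_eigenspace_eq_top (x : G) : ⨆ μ, Module.End.eigenspace (ρ x) μ = ⊤ := by
  have hss : Module.End.IsSemisimple (ρ x) := by
    refine Module.End.isSemisimple_of_squarefree_aeval_eq_zero
      (p := Polynomial.X ^ Nat.card G - 1) ?_ ?_
    · refine (Polynomial.X_pow_sub_one_separable_iff.2 ?_).squarefree
      exact_mod_cast Nat.card_pos.ne'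
    · simp [pow_natCard_eq_one]
  rw [← Module.End.iSup_maxGenEigenspace_eq_top (ρ x)]
  exact iSup_congr fun μ =>
    (hss.isFinitelySemisimple.maxGenEigenspace_eq_eigenspace μ).symm

/-- Both `χ(x)` and `χ(x⁻¹)` are computed from the multiplicities of the eigenvalues of `ρ x`. -/
theorem exists_character_eq_sum_eigenvalues (x : G) : ∃ s : Finset ℂ,
    (∀ μ, μ ∈ s ↔ Module.End.eigenspace (ρ x) μ ≠ ⊥) ∧
    ρ.character x = ∑ μ ∈ s, (Module.finrank ℂ (Module.End.eigenspace (ρ x) μ) : ℂ) * μ ∧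
    ρ.character x⁻¹ = ∑ μ ∈ s, (Module.finrank ℂ (Module.End.eigenspace (ρ x) μ) : ℂ) * μ⁻¹ ∧
    ρ.character 1 = ∑ μ ∈ s, (Module.finrank ℂ (Module.End.eigenspace (ρ x) μ) : ℂ) := by
  classical
  have hind := Module.End.eigenspaces_iSupIndep (ρ x)
  have hint := DirectSum.isInternal_submodule_of_iSupIndep_of_iSup_eq_top hind
    (ρ.iSup_eigenspace_eq_top x)
  have hfin : {μ | Module.End.eigenspace (ρ x) μ ≠ ⊥}.Finite :=
    WellFoundedGT.finite_ne_bot_of_iSupIndep hind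
  have key : ∀ (A : Module.End ℂ V) (c : ℂ → ℂ),
      (∀ μ, ∀ v ∈ Module.End.eigenspace (ρ x) μ, A v = c μ • v) →
      LinearMap.trace ℂ V A =
        ∑ μ ∈ hfin.toFinset, (Module.finrank ℂ (Module.End.eigenspace (ρ x) μ) : ℂ) * c μ := by
    intro A c hA
    have hm : ∀ μ, Set.MapsTo A (Module.End.eigenspace (ρ x) μ) (Module.End.eigenspace (ρ x) μ) := fun μ v hv => by
      rw [SetLike.mem_coe, hA μ v hv]
      exact Submodule.smul_mem _ _ hv
    rw [LinearMap.trace_eq_sum_trace_restrict' hint hfin hm]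
    refine Finset.sum_congr rfl fun μ _ => ?_
    have : A.restrict (hm μ) = c μ • LinearMap.id := by
      ext v
      simpa using! hA μ v v.2
    rw [this, map_smul, LinearMap.trace_id, smul_eq_mul, mul_comm]
  refine ⟨hfin.toFinset, fun μ => by simp, ?_, ?_, ?_⟩
  · exact key _ _ fun μ v hv => Module.End.mem_eigenspace_iff.1 hv
  · refine key _ _ fun μ v hv => ?_
    by_cases hb : Module.End.eigenspace (ρ x) μ = ⊥
    · rw [hb, Submodule.mem_bot] at hv
      simp [hv]
    · have hμ : μ ≠ 0 := by
        rintro rfl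
        have := ρ.pow_natCard_eq_one_of_eigenspace_ne_bot hb
        rw [zero_pow Nat.card_pos.ne'] at this
        exact zero_ne_one this
      have h1 : ρ x v = μ • v := Module.End.mem_eigenspace_iff.1 hv
      have h2 : ρ x⁻¹ (ρ x v) = v := by
        rw [← Module.End.mul_apply, ← map_mul, inv_mul_cancel, map_one, Module.End.one_apply]
      rw [h1, map_smul] at h2
      rw [eq_inv_smul_iff₀ hμ]
      exact h2
  · have := key (ρ 1) (fun _ => 1) (fun μ v _ => by simp)
    simpa using! this

theorem character_inv (x : G) : ρ.character x⁻¹ = starRingEnd ℂ (ρ.character x) := by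
  obtain ⟨s, hs, h1, h2, -⟩ := ρ.exists_character_eq_sum_eigenvalues x
  rw [h1, h2, map_sum]
  refine Finset.sum_congr rfl fun μ hμ => ?_
  rw [map_mul, Complex.conj_natCast, Complex.inv_eq_conj]
  exact Complex.norm_eq_one_of_pow_eq_one
    (ρ.pow_natCard_eq_one_of_eigenspace_ne_bot ((hs μ).1 hμ)) Nat.card_pos.ne'

theorem isIntegral_character (x : G) : IsIntegral ℤ (ρ.character x) := by
  obtain ⟨s, hs, h1, -⟩ := ρ.exists_character_eq_sum_eigenvalues x
  rw [h1]
  refine IsIntegral.sum _ fun μ hμ => (isIntegral_algebraMap (R := ℤ)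
    (x := (Module.finrank ℂ (Module.End.eigenspace (ρ x) μ) : ℤ))).mul ?_ |> fun h => by simpa using h
  refine IsIntegral.of_pow (n := Nat.card G) Nat.card_pos ?_
  rw [ρ.pow_natCard_eq_one_of_eigenspace_ne_bot ((hs μ).1 hμ)]
  exact isIntegral_one

/-- With multiplicity, χ(x) is a sum of χ(1) roots of unity. Each has real part at most 1, so
equality forces every eigenvalue to be 1, and `ρ x` is diagonalizable. -/
theorem character_eq_character_one_iff (x : G) : ρ.character x = ρ.character 1 ↔ ρ x = 1 := by
  refine ⟨fun h => ?_, fun h => by simp [character, h]⟩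
  obtain ⟨s, hs, h1, -, h3⟩ := ρ.exists_character_eq_sum_eigenvalues x
  have hnorm : ∀ μ ∈ s, ‖μ‖ = 1 := fun μ hμ => Complex.norm_eq_one_of_pow_eq_one
    (ρ.pow_natCard_eq_one_of_eigenspace_ne_bot ((hs μ).1 hμ)) Nat.card_pos.ne'
  have hz : ∑ μ ∈ s, (Module.finrank ℂ (Module.End.eigenspace (ρ x) μ) : ℝ) * (1 - μ.re) = 0 := by
    have := congrArg Complex.re (h1.symm.trans (h.trans h3))
    simp only [Complex.re_sum, Complex.mul_re, Complex.natCast_re, Complex.natCast_im,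
      zero_mul, sub_zero] at this
    simp only [mul_sub, mul_one, Finset.sum_sub_distrib, this, sub_self]
  rw [Finset.sum_eq_zero_iff_of_nonneg fun μ hμ => mul_nonneg (Nat.cast_nonneg _)
    (sub_nonneg.2 ((Complex.re_le_norm μ).trans (hnorm μ hμ).le))] at hz
  have hone : ∀ μ, Module.End.eigenspace (ρ x) μ ≠ ⊥ → μ = 1 := by
    intro μ hμ
    have hμs := (hs μ).2 hμ
    rcases mul_eq_zero.1 (hz μ hμs) with h | h
    · rw [Nat.cast_eq_zero, Submodule.finrank_eq_zero] at h
      exact absurd h hμ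
    · have hre : μ.re = 1 := by linarith
      have hn := Complex.sq_norm μ
      rw [hnorm μ hμs, Complex.normSq_apply, hre] at hn
      refine Complex.ext hre ?_
      have : μ.im * μ.im = 0 := by linarith
      simpa using this
  have htop : Module.End.eigenspace (ρ x) 1 = ⊤ := by
    rw [eq_top_iff, ← ρ.iSup_eigenspace_eq_top x]
    refine iSup_le fun μ => ?_
    by_cases hb : Module.End.eigenspace (ρ x) μ = ⊥
    · rw [hb]; exact bot_le
    · rw [hone μ hb]
  ext v
  have : v ∈ Module.End.eigenspace (ρ x) 1 := htop ▸ Submodule.mem_top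
  simpa using Module.End.mem_eigenspace_iff.1 this

end Eigenspaces

end Representation

/-! ### Completeness of the irreducible characters among class functions. -/

/-- As `f` is a class function, the operator commutes with `ρ`, so it is a scalar by Schur; its
trace is the sum in `h0`, which is zero. -/
theorem sum_smul_eq_zero_of_isIrreducible {G V : Type*} [Group G] [Fintype G] [AddCommGroup V]
    [Module ℂ V] [FiniteDimensional ℂ V] {f : G → ℂ} (hf : ∀ x h, f (h * x * h⁻¹) = f x)
    (h0 : ∀ ψ ∈ Irr G, ∑ x, f x * ψ x⁻¹ = 0) (ρ : Representation ℂ G V) (hρ : ρ.IsIrreducible) :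
    ∑ x, f x • ρ x⁻¹ = 0 := by
  have hcomm : ∀ g, Commute (∑ x, f x • ρ x⁻¹) (ρ g) := by
    intro g
    rw [Commute, SemiconjBy, Finset.sum_mul, Finset.mul_sum]
    refine Fintype.sum_equiv (MulAut.conj g⁻¹).toEquiv _ _ fun x => ?_
    have : (MulAut.conj g⁻¹).toEquiv x = g⁻¹ * x * g⁻¹⁻¹ := rfl
    rw [this, hf, smul_mul_assoc, mul_smul_comm, ← map_mul, ← map_mul]
    congr 2
    group
  obtain ⟨c, hc⟩ := hρ.exists_eq_smul_one _ hcomm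
  have htr := congrArg (LinearMap.trace ℂ V) hc
  have h1 := h0 _ (ρ.character_mem_Irr hρ)
  simp only [map_sum, map_smul, smul_eq_mul] at htr
  simp only [Representation.character] at h1
  rw [h1, LinearMap.trace_one] at htr
  have := hρ.nontrivial
  have hn : (Module.finrank ℂ V : ℂ) ≠ 0 := by exact_mod_cast Module.finrank_pos.ne'
  rcases mul_eq_zero.1 htr.symm with h | h
  · rw [hc, h, zero_smul]
  · exact absurd h hn

/-- A class function orthogonal to all irreducible characters vanishes. -/
theorem eq_zero_of_forall_sum_mul_Irr_eq_zero {G : Type*} [Group G] [Fintype G] {f : G → ℂ}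
    (hf : ∀ x h, f (h * x * h⁻¹) = f x) (h0 : ∀ ψ ∈ Irr G, ∑ x, f x * ψ x⁻¹ = 0) : f = 0 := by
  have : NeZero (Nat.card G : ℂ) := ⟨by exact_mod_cast Nat.card_pos.ne'⟩
  -- By the previous lemma `a` kills each simple submodule of ℂ[G], hence by semisimplicity all of
  -- ℂ[G], in particular 1. Its coefficient at x⁻¹ is `f x`.
  set a : ℂ[G] := ∑ x, f x • MonoidAlgebra.of ℂ G x⁻¹ with ha
  have hsimple : ∀ S : Submodule ℂ[G] ℂ[G], IsSimpleModule ℂ[G] S → ∀ v ∈ S, a • v = 0 := by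
    intro S hS v hv
    let ρ : Representation ℂ G S :=
      ((Algebra.lsmul ℂ ℂ S : ℂ[G] →ₐ[ℂ] Module.End ℂ S) : ℂ[G] →* Module.End ℂ S).comp
        (MonoidAlgebra.of ℂ G)
    have hρ : ∀ g (w : S), ρ g w = MonoidAlgebra.of ℂ G g • w := fun _ _ => rfl
    have hfd : FiniteDimensional ℂ S :=
      inferInstanceAs (FiniteDimensional ℂ (S.restrictScalars ℂ))
    have hirr : ρ.IsIrreducible := by
      rw [Representation.isIrreducible_iff_forall_invariant]
      refine ⟨IsSimpleModule.nontrivial ℂ[G] S, fun U hU => ?_⟩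
      let U' : Submodule ℂ[G] S :=
        { U.toAddSubmonoid with
          smul_mem' := by
            intro b w hw
            induction b using MonoidAlgebra.induction_on with
            | of g => exact hU g w hw
            | add b c hb hc => rw [add_smul]; exact U.add_mem hb hc
            | smul r b hb => rw [smul_assoc]; exact U.smul_mem r hb }
      have hmem : ∀ w, w ∈ U' ↔ w ∈ U := fun _ => Iff.rfl
      rcases eq_bot_or_eq_top U' with h | h
      · left; ext w; rw [← hmem, h]; simp
      · right; ext w; rw [← hmem, h]; simp
    have hz := LinearMap.congr_fun (sum_smul_eq_zero_of_isIrreducible hf h0 ρ hirr) ⟨v, hv⟩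
    have hz' : a • (⟨v, hv⟩ : S) = 0 := by
      simp only [LinearMap.sum_apply, LinearMap.smul_apply, hρ, LinearMap.zero_apply] at hz
      simp only [ha, Finset.sum_smul, smul_assoc]
      exact hz
    exact congrArg Subtype.val hz'
  have hall : ∀ v : ℂ[G], a • v = 0 := by
    intro v
    have hv : v ∈ sSup {S : Submodule ℂ[G] ℂ[G] | IsSimpleModule ℂ[G] S} := by
      rw [IsSemisimpleModule.sSup_simples_eq_top]; trivial
    rw [sSup_eq_iSup'] at hv
    induction hv using Submodule.iSup_induction' with
    | mem S w hw => exact hsimple S.1 S.2 w hw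
    | zero => exact smul_zero a
    | add v w _ _ hv hw => rw [smul_add, hv, hw, add_zero]
  have ha0 : a = 0 := by simpa using hall 1
  ext x
  have hx : MonoidAlgebra.coeff a x⁻¹ = f x := by
    classical
    rw [ha]
    simp [MonoidAlgebra.coeff_sum, Finsupp.finsetSum_apply, Finsupp.single_apply]
  rw [← hx, ha0]
  simp

/-! ### Irreducible characters: values, kernels, orthogonality, separation. -/

section Irr

variable {G : Type*} [Group G] {ψ χ : G → ℂ}

theorem Irr.apply_conj (hψ : ψ ∈ Irr G) (x h : G) : ψ (h * x * h⁻¹) = ψ x := by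
  obtain ⟨n, ρ, hρ, rfl⟩ := hψ
  exact ρ.char_conj x h

theorem Irr.apply_eq_of_isConj (hψ : ψ ∈ Irr G) {x y : G} (h : IsConj x y) : ψ x = ψ y := by
  obtain ⟨c, rfl⟩ := isConj_iff.1 h
  exact (Irr.apply_conj hψ x c).symm

theorem Irr.exists_apply_one_eq (hψ : ψ ∈ Irr G) : ∃ d : ℕ, 0 < d ∧ ψ 1 = d := by
  obtain ⟨n, ρ, hρ, rfl⟩ := hψ
  have := hρ.nontrivial
  exact ⟨_, Module.finrank_pos (R := ℂ) (M := Fin n → ℂ), ρ.char_one⟩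

theorem Irr.apply_one_ne_zero (hψ : ψ ∈ Irr G) : ψ 1 ≠ 0 := by
  obtain ⟨d, hd, h⟩ := Irr.exists_apply_one_eq hψ
  rw [h]
  exact_mod_cast hd.ne'

/-- Homomorphisms to `ℂˣ` are irreducible characters. -/
theorem coe_monoidHom_mem_Irr (f : G →* ℂˣ) : (fun x => (f x : ℂ)) ∈ Irr G := by
  let ρ : Representation ℂ G ℂ :=
    { toFun := fun x => (f x : ℂ) • 1
      map_one' := by simp
      map_mul' := fun a b => by simp [smul_smul, mul_comm] }
  have hirr : ρ.IsIrreducible := by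
    rw [Representation.isIrreducible_iff_forall_invariant]
    exact ⟨inferInstance, fun U _ => eq_bot_or_eq_top U⟩
  have := ρ.character_mem_Irr hirr
  convert this using 1
  ext x
  simp [Representation.character, ρ]

theorem one_mem_Irr : (fun _ => 1 : G → ℂ) ∈ Irr G := by
  simpa using coe_monoidHom_mem_Irr (1 : G →* ℂˣ)

/-- Translation by a central element scales an irreducible character, by a factor that is `1` only
if the element lies in the kernel. -/
theorem Irr.exists_apply_center_mul (hψ : ψ ∈ Irr G) {z : G} (hz : z ∈ Subgroup.center G) :
    ∃ c : ℂ, (∀ x, ψ (z * x) = c * ψ x) ∧ (c = 1 ↔ ψ z = ψ 1) := by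
  have h1 := Irr.apply_one_ne_zero hψ
  obtain ⟨n, ρ, hρ, rfl⟩ := hψ
  obtain ⟨c, hc⟩ := hρ.exists_eq_smul_one (ρ z) fun g => by
    rw [Commute, SemiconjBy, ← map_mul, ← map_mul, Subgroup.mem_center_iff.1 hz g]
  have h : ∀ x, ρ.character (z * x) = c * ρ.character x := fun x => by
    simp [Representation.character, hc]
  refine ⟨c, h, ?_⟩
  rw [← mul_one z, h 1]
  exact ⟨fun h => by simp [h], fun h => mul_right_cancel₀ h1 (by simpa using h)⟩

theorem Irr.comp_mk_mem {N : Subgroup G} [N.Normal] {φ : G ⧸ N → ℂ} (hφ : φ ∈ Irr (G ⧸ N)) :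
    (fun x : G => φ (x : G ⧸ N)) ∈ Irr G := by
  obtain ⟨n, ρ, hρ, rfl⟩ := hφ
  refine ⟨n, ρ.comp (QuotientGroup.mk' N), ?_, rfl⟩
  rw [Representation.isIrreducible_iff_forall_invariant] at hρ ⊢
  refine ⟨hρ.1, fun U hU => hρ.2 U fun g v hv => ?_⟩
  obtain ⟨g, rfl⟩ := QuotientGroup.mk_surjective g
  exact hU g v hv

section Finite

variable [Finite G]

theorem Irr.apply_inv (hψ : ψ ∈ Irr G) (x : G) : ψ x⁻¹ = starRingEnd ℂ (ψ x) := by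
  obtain ⟨n, ρ, hρ, rfl⟩ := hψ
  exact ρ.character_inv x

theorem Irr.isIntegral_apply (hψ : ψ ∈ Irr G) (x : G) : IsIntegral ℤ (ψ x) := by
  obtain ⟨n, ρ, hρ, rfl⟩ := hψ
  exact ρ.isIntegral_character x

theorem Irr.exists_subgroup_eq_charKer (hψ : ψ ∈ Irr G) : ∃ K : Subgroup G, K.Normal ∧
    (K : Set G) = charKer ψ ∧ ∀ k ∈ K, ∀ x, ψ (k * x) = ψ x := by
  obtain ⟨n, ρ, hρ, rfl⟩ := hψ
  refine ⟨ρ.ker, inferInstance, ?_, ?_⟩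
  · ext x
    rw [SetLike.mem_coe, MonoidHom.mem_ker]
    exact (ρ.character_eq_character_one_iff x).symm
  · intro k hk x
    simp [Representation.character, MonoidHom.mem_ker.1 hk]

theorem Irr.sum_mul_inv_self [Fintype G] (hψ : ψ ∈ Irr G) :
    ∑ x, ψ x * ψ x⁻¹ = Nat.card G := by
  classical
  obtain ⟨n, ρ, hρ, rfl⟩ := hψ
  let _ : Invertible (Nat.card G : ℂ) :=
    invertibleOfNonzero (by exact_mod_cast Nat.card_pos.ne')
  have h := ρ.char_orthonormal ρ
  rw [if_pos ⟨Representation.Equiv.refl ρ⟩,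
    inv_mul_eq_iff_eq_mul₀ (by exact_mod_cast Nat.card_pos.ne')] at h
  simpa using h

theorem Irr.sum_mul_inv_of_ne [Fintype G] (hψ : ψ ∈ Irr G) (hχ : χ ∈ Irr G) (hne : ψ ≠ χ) :
    ∑ x, ψ x * χ x⁻¹ = 0 := by
  classical
  obtain ⟨n, ρ, hρ, rfl⟩ := hψ
  obtain ⟨m, σ, hσ, rfl⟩ := hχ
  let _ : Invertible (Nat.card G : ℂ) :=
    invertibleOfNonzero (by exact_mod_cast Nat.card_pos.ne')
  have h := ρ.char_orthonormal σ
  rw [if_neg (fun ⟨e⟩ => hne (Representation.char_iso e).symm),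
    inv_mul_eq_iff_eq_mul₀ (by exact_mod_cast Nat.card_pos.ne')] at h
  simpa using h

theorem Irr.mem_inflatedIrr_iff (hψ : ψ ∈ Irr G) (N : Subgroup G) [N.Normal] :
    ψ ∈ inflatedIrr N ↔ (N : Set G) ⊆ charKer ψ := by
  constructor
  · rintro ⟨φ, hφ, rfl⟩ x hx
    have : (x : G ⧸ N) = ((1 : G) : G ⧸ N) := by
      rw [QuotientGroup.mk_one]
      exact (QuotientGroup.eq_one_iff x).2 hx
    simp [charKer, this]
  · intro h
    obtain ⟨n, ρ, hρ, rfl⟩ := hψ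
    have hker : N ≤ ρ.ker := fun x hx =>
      MonoidHom.mem_ker.2 ((ρ.character_eq_character_one_iff x).1 (h hx))
    let σ : Representation ℂ (G ⧸ N) (Fin n → ℂ) := QuotientGroup.lift N ρ hker
    refine ⟨σ.character, ⟨n, σ, ?_, rfl⟩, rfl⟩
    rw [Representation.isIrreducible_iff_forall_invariant] at hρ ⊢
    exact ⟨hρ.1, fun U hU => hρ.2 U fun g v hv => hU g v hv⟩

/-- Sum of a character over a union of cosets of the centre. -/
theorem Irr.sum_eq_zero_of_center_stable (hψ : ψ ∈ Irr G)
    (h : ψ ∉ inflatedIrr (Subgroup.center G)) (s : Finset G)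
    (hs : ∀ z ∈ Subgroup.center G, ∀ x ∈ s, z * x ∈ s) : ∑ x ∈ s, ψ x⁻¹ = 0 := by
  rw [Irr.mem_inflatedIrr_iff hψ, Set.not_subset] at h
  obtain ⟨z, hz, hzψ⟩ := h
  obtain ⟨c, hc, hc1⟩ := Irr.exists_apply_center_mul hψ hz
  have hc1 : c ≠ 1 := fun h => hzψ (hc1.1 h)
  -- Reindex by x ↦ zx, where z is a central element outside ker ψ.
  have : ∑ x ∈ s, ψ x⁻¹ = c * ∑ x ∈ s, ψ x⁻¹ := by
    rw [Finset.mul_sum]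
    refine Finset.sum_bij' (fun x _ => z * x) (fun x _ => z⁻¹ * x) (fun x hx => hs z hz x hx)
      (fun x hx => hs _ (inv_mem hz) x hx) (by simp) (by simp) fun x hx => ?_
    rw [← hc, mul_inv_rev, ← Subgroup.mem_center_iff.1 hz, inv_mul_cancel_right]
  have h2 : (1 - c) * ∑ x ∈ s, ψ x⁻¹ = 0 := by rw [sub_mul, one_mul, ← this, sub_self]
  exact (mul_eq_zero.1 h2).resolve_left (sub_ne_zero.2 hc1.symm)

theorem Irr.sum_filter_isConj_inv [Fintype G] (hψ : ψ ∈ Irr G) (g : G) [DecidablePred (IsConj g)] :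
    ∑ x with IsConj g x, ψ x⁻¹ = Nat.card (conjugatesOf g) * ψ g⁻¹ := by
  rw [Finset.sum_congr rfl (g := fun _ => ψ g⁻¹), Finset.sum_const, nsmul_eq_mul]
  · congr 2
    rw [← Set.ncard_coe_finset, ← Nat.card_coe_set_eq]
    simp [conjugatesOf]
  · intro x hx
    rw [Irr.apply_inv hψ, Irr.apply_inv hψ, Irr.apply_eq_of_isConj hψ (Finset.mem_filter.1 hx).2]

/-- The irreducible characters separate the nontrivial elements from the identity. -/
theorem exists_mem_Irr_apply_ne {x : G} (hx : x ≠ 1) : ∃ ψ ∈ Irr G, ψ x ≠ ψ 1 := by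
  classical
  by_contra! h
  have := Fintype.ofFinite G
  -- The weight at 1 makes the pairing of `f` with ψ a multiple of conj(ψ(x) − ψ(1)).
  set f : G → ℂ := fun y =>
    (if IsConj x y then 1 else 0) - (if y = 1 then (Nat.card (conjugatesOf x) : ℂ) else 0) with hf
  have hfc : ∀ y k, f (k * y * k⁻¹) = f y := by
    intro y k
    have h1 : IsConj x (k * y * k⁻¹) ↔ IsConj x y :=
      have hc : IsConj y (k * y * k⁻¹) := isConj_iff.2 ⟨k, rfl⟩
      ⟨fun h => h.trans hc.symm, fun h => h.trans hc⟩
    simp only [hf, h1, conj_eq_one_iff]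
  have h0 : f = 0 := eq_zero_of_forall_sum_mul_Irr_eq_zero hfc fun ψ hψ => by
    simp only [hf, sub_mul, Finset.sum_sub_distrib, ite_mul, one_mul, zero_mul,
      Finset.sum_ite_eq', Finset.mem_univ, if_true, ← Finset.sum_filter (IsConj x),
      Irr.sum_filter_isConj_inv hψ]
    rw [Irr.apply_inv hψ, Irr.apply_inv hψ, h ψ hψ, sub_self]
  have h1 := congrFun h0 1
  have h2 : ¬ IsConj x 1 := fun h => hx (isConj_one_right.1 h.symm)
  have h3 : Nat.card (conjugatesOf x) ≠ 0 :=
    (Nat.card_pos_iff.2 ⟨⟨⟨x, mem_conjugatesOf_self⟩⟩, inferInstance⟩).ne'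
  simp only [hf, if_neg h2, if_true, zero_sub, Pi.zero_apply, neg_eq_zero, Nat.cast_eq_zero] at h1
  exact h3 h1

/-- An element outside a normal subgroup is detected by an irreducible character trivial on that
subgroup. -/
theorem exists_mem_Irr_subset_charKer_apply_ne (N : Subgroup G) [N.Normal] {x : G} (hx : x ∉ N) :
    ∃ ψ ∈ Irr G, (N : Set G) ⊆ charKer ψ ∧ ψ x ≠ ψ 1 := by
  have : (x : G ⧸ N) ≠ 1 := fun h => hx ((QuotientGroup.eq_one_iff x).1 h)
  obtain ⟨φ, hφ, hne⟩ := exists_mem_Irr_apply_ne this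
  have hmem := Irr.comp_mk_mem hφ
  exact ⟨_, hmem, (Irr.mem_inflatedIrr_iff hmem N).1 ⟨φ, hφ, rfl⟩, hne⟩

theorem exists_monoidHom_apply_ne_one_of_notMem_commutator {x : G} (hx : x ∉ commutator G) :
    ∃ f : G →* ℂˣ, f x ≠ 1 := by
  have hne : Abelianization.of x ≠ 1 := fun h => hx (by
    rwa [← MonoidHom.mem_ker, Abelianization.ker_of] at h)
  have : Finite (Abelianization G) := inferInstanceAs (Finite (G ⧸ _))
  obtain ⟨f, hf⟩ :=
    CommGroup.exists_apply_ne_one_of_hasEnoughRootsOfUnity (Abelianization G) ℂ hne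
  exact ⟨f.comp Abelianization.of, hf⟩

end Finite

end Irr

/-! ### Equivalence of the two conditions, and the subgroup Z ∪ g^G. -/

section VanishesOnNoncentralExcept

variable {G : Type*} [Group G] {χ : G → ℂ} {g : G}

theorem isConj_conj_iff {x k : G} : IsConj g (k * x * k⁻¹) ↔ IsConj g x :=
  have hc : IsConj x (k * x * k⁻¹) := isConj_iff.2 ⟨k, rfl⟩
  ⟨fun h => h.trans hc.symm, fun h => h.trans hc⟩

theorem Subgroup.Normal.mem_conj_iff {N : Subgroup G} (hN : N.Normal) {x k : G} :
    k * x * k⁻¹ ∈ N ↔ x ∈ N :=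
  ⟨fun h => by simpa [mul_assoc] using hN.conj_mem _ h k⁻¹, fun h => hN.conj_mem _ h k⟩

/-- Otherwise χ(zg) = 0 although χ(zg) = cχ(g), so c = 0, and then χ(1) = χ(z z⁻¹) = 0. -/
theorem VanishesOnNoncentralExcept.isConj_mul (h : VanishesOnNoncentralExcept χ g)
    (hχ : χ ∈ Irr G) {z : G} (hz : z ∈ Subgroup.center G) : IsConj g (z * g) := by
  obtain ⟨hg, hg0, hv⟩ := h
  by_contra hn
  obtain ⟨c, hc, -⟩ := Irr.exists_apply_center_mul hχ hz
  have hzg : z * g ∉ Subgroup.center G := fun h =>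
    hg ((Subgroup.mul_mem_cancel_left _ hz).1 h)
  have h0 := hv _ hzg hn
  rw [hc] at h0
  have hc0 : c = 0 := (mul_eq_zero.1 h0).resolve_right hg0
  have h1 := hc z⁻¹
  rw [mul_inv_cancel, hc0, zero_mul] at h1
  exact Irr.apply_one_ne_zero hχ h1

theorem sum_filter_mem_eq [Fintype G] {ψ : G → ℂ} (N : Subgroup G)
    [DecidablePred (· ∈ N)] (hN : (N : Set G) ⊆ charKer ψ) :
    ∑ x with x ∈ N, ψ x⁻¹ = Nat.card N * ψ 1 := by
  rw [Finset.sum_congr rfl (g := fun _ => ψ 1), Finset.sum_const, nsmul_eq_mul]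
  · rw [Nat.card_eq_fintype_card, Fintype.card_subtype]
  · intro x hx
    exact hN (inv_mem (Finset.mem_filter.1 hx).2)

theorem VanishesOnNoncentralExcept.center_subset_charKer (h : VanishesOnNoncentralExcept χ g)
    (hχ : χ ∈ Irr G) : (Subgroup.center G : Set G) ⊆ charKer χ := by
  intro z hz
  obtain ⟨c, hc, hc1⟩ := Irr.exists_apply_center_mul hχ hz
  have h1 := Irr.apply_eq_of_isConj hχ (h.isConj_mul hχ hz)
  rw [hc] at h1
  exact hc1.1 (mul_right_cancel₀ h.2.1 (by rw [← h1, one_mul]))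

/-- A sum over a set containing `Z(G)` and `g ^ G` of a function vanishing off these. -/
theorem sum_eq_sum_center_add_sum_isConj [Fintype G] [DecidablePred (· ∈ Subgroup.center G)]
    [DecidablePred (IsConj g)] (hg : g ∉ Subgroup.center G) (F : G → ℂ) (s : Finset G)
    (hs : ∀ x, x ∈ Subgroup.center G ∨ IsConj g x → x ∈ s)
    (hF : ∀ x, x ∉ Subgroup.center G → ¬ IsConj g x → F x = 0) :
    ∑ x ∈ s, F x = ∑ x with x ∈ Subgroup.center G, F x + ∑ x with IsConj g x, F x := by
  classical
  rw [← Finset.sum_union]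
  · symm
    refine Finset.sum_subset (fun x hx => hs x (by simpa using hx)) fun x _ hx => ?_
    simp only [Finset.mem_union, Finset.mem_filter, Finset.mem_univ, true_and, not_or] at hx
    exact hF x hx.1 hx.2
  · rw [Finset.disjoint_filter]
    rintro x - hx hgx
    obtain ⟨c, rfl⟩ := isConj_iff.1 hgx
    refine hg ?_
    simpa [mul_assoc] using (inferInstance : (Subgroup.center G).Normal).conj_mem _ hx c⁻¹

variable [Finite G]

theorem Irr.sum_filter_mem_center_eq_zero [Fintype G] {ψ : G → ℂ} (hψ : ψ ∈ Irr G)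
    (h : ψ ∉ inflatedIrr (Subgroup.center G)) (N : Subgroup G) (hN : Subgroup.center G ≤ N)
    [DecidablePred (· ∈ N)] : ∑ x with x ∈ N, ψ x⁻¹ = 0 :=
  Irr.sum_eq_zero_of_center_stable hψ h _ fun z hz x hx => by
    simp only [Finset.mem_filter, Finset.mem_univ, true_and] at hx ⊢
    exact mul_mem (hN hz) hx

theorem natCard_conjugatesOf_pos (g : G) : 0 < Nat.card (conjugatesOf g) :=
  Nat.card_pos_iff.2 ⟨⟨⟨g, mem_conjugatesOf_self⟩⟩, inferInstance⟩

/-- The inner product of `χ` with another irreducible character. -/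
theorem VanishesOnNoncentralExcept.sum_mul_inv [Fintype G]
    [DecidablePred (· ∈ Subgroup.center G)] (h : VanishesOnNoncentralExcept χ g)
    (hχ : χ ∈ Irr G) {ψ : G → ℂ} (hψ : ψ ∈ Irr G) :
    ∑ x, χ x * ψ x⁻¹ = χ 1 * ∑ x with x ∈ Subgroup.center G, ψ x⁻¹ +
      Nat.card (conjugatesOf g) * χ g * ψ g⁻¹ := by
  classical
  rw [sum_eq_sum_center_add_sum_isConj h.1 _ _ (fun x _ => Finset.mem_univ x)
    fun x hx hgx => by rw [h.2.2 x hx hgx, zero_mul], Finset.mul_sum]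
  congr 1
  · refine Finset.sum_congr rfl fun x hx => ?_
    rw [h.center_subset_charKer hχ (Finset.mem_filter.1 hx).2]
  · rw [mul_right_comm, ← Irr.sum_filter_isConj_inv hψ, mul_comm, Finset.mul_sum]
    refine Finset.sum_congr rfl fun x hx => ?_
    rw [Irr.apply_eq_of_isConj hχ (Finset.mem_filter.1 hx).2]

/-- Orthogonality of χ to the trivial character, which differs from χ because χ is nonlinear. -/
theorem VanishesOnNoncentralExcept.card_mul_add_card_mul (h : VanishesOnNoncentralExcept χ g)
    (hχ : χ ∈ Irr G) (h1 : χ 1 ≠ 1) :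
    (Nat.card (Subgroup.center G) : ℂ) * χ 1 + Nat.card (conjugatesOf g) * χ g = 0 := by
  classical
  have := Fintype.ofFinite G
  have hs := h.sum_mul_inv hχ one_mem_Irr
  rw [Irr.sum_mul_inv_of_ne hχ one_mem_Irr (fun e => h1 (congrFun e 1)),
    show ∑ x with x ∈ Subgroup.center G, (1 : ℂ) = Nat.card (Subgroup.center G) * 1 from
      sum_filter_mem_eq (ψ := fun _ => 1) _ fun _ _ => rfl] at hs
  rw [hs]
  ring

theorem VanishesOnNoncentralExcept.apply_eq (h : VanishesOnNoncentralExcept χ g)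
    (hχ : χ ∈ Irr G) (h1 : χ 1 ≠ 1) :
    χ g = -((Nat.card (Subgroup.center G) : ℂ) * χ 1 / (Nat.card (conjugatesOf g) : ℂ)) := by
  have hk : (Nat.card (conjugatesOf g) : ℂ) ≠ 0 := by exact_mod_cast (natCard_conjugatesOf_pos g).ne'
  have := h.card_mul_add_card_mul hχ h1
  field_simp
  linear_combination this

theorem VanishesOnNoncentralExcept.othersTrivialOrVanishAt (h : VanishesOnNoncentralExcept χ g)
    (hχ : χ ∈ Irr G) (h1 : χ 1 ≠ 1) : OthersTrivialOrVanishAt χ g := by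
  classical
  have := Fintype.ofFinite G
  have hk : (Nat.card (conjugatesOf g) : ℂ) ≠ 0 := by
    exact_mod_cast (natCard_conjugatesOf_pos g).ne'
  refine ⟨h.1, fun ψ hψ hne => ?_⟩
  have hs := h.sum_mul_inv hχ hψ
  rw [Irr.sum_mul_inv_of_ne hχ hψ hne.symm] at hs
  refine ⟨fun hi => ?_, fun hi => ?_⟩
  · rw [sum_filter_mem_eq _ ((Irr.mem_inflatedIrr_iff hψ _).1 hi)] at hs
    have h2 := h.card_mul_add_card_mul hχ h1
    -- Subtract ψ(1) times the relation coming from the trivial character.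
    have h3 : (Nat.card (conjugatesOf g) * χ g) * (ψ g⁻¹ - ψ 1) = 0 := by
      linear_combination -hs - ψ 1 * h2
    have h4 := sub_eq_zero.1 ((mul_eq_zero.1 h3).resolve_left (mul_ne_zero hk h.2.1))
    rw [Irr.apply_inv hψ] at h4
    have h5 := congrArg (starRingEnd ℂ) h4
    rwa [← Irr.apply_inv hψ 1, Complex.conj_conj, inv_one] at h5
  · rw [Irr.sum_filter_mem_center_eq_zero hψ hi _ le_rfl, mul_zero, zero_add] at hs
    have h4 := (mul_eq_zero.1 hs.symm).resolve_left (mul_ne_zero hk h.2.1)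
    rw [Irr.apply_inv hψ] at h4
    simpa using h4

theorem OthersTrivialOrVanishAt.apply_inv_eq_apply_one (h : OthersTrivialOrVanishAt χ g)
    {ψ : G → ℂ} (hψ : ψ ∈ Irr G) (hne : ψ ≠ χ) (hi : ψ ∈ inflatedIrr (Subgroup.center G)) :
    ψ g⁻¹ = ψ 1 := by
  rw [Irr.apply_inv hψ, ((h.2 ψ hψ hne).1 hi : ψ g = ψ 1), ← Irr.apply_inv hψ, inv_one]

theorem OthersTrivialOrVanishAt.apply_inv_eq_zero (h : OthersTrivialOrVanishAt χ g)
    {ψ : G → ℂ} (hψ : ψ ∈ Irr G) (hne : ψ ≠ χ) (hi : ψ ∉ inflatedIrr (Subgroup.center G)) :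
    ψ g⁻¹ = 0 := by
  rw [Irr.apply_inv hψ, (h.2 ψ hψ hne).2 hi, map_zero]

theorem OthersTrivialOrVanishAt.vanishesOnNoncentralExcept (h : OthersTrivialOrVanishAt χ g)
    (hχ : χ ∈ Irr G) : VanishesOnNoncentralExcept χ g := by
  classical
  have := Fintype.ofFinite G
  -- The weights balance the contributions of g^G and Z against any ψ trivial on Z and g; for the
  -- other ψ ≠ χ both contributions vanish.
  set F : G → ℂ := fun x =>
    (if IsConj g x then (Nat.card (Subgroup.center G) : ℂ) else 0) -
      (if x ∈ Subgroup.center G then (Nat.card (conjugatesOf g) : ℂ) else 0) with hF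
  have hFsum : ∀ ψ ∈ Irr G, ∑ x, F x * ψ x⁻¹ =
      Nat.card (Subgroup.center G) * (Nat.card (conjugatesOf g) * ψ g⁻¹) -
        Nat.card (conjugatesOf g) * ∑ x with x ∈ Subgroup.center G, ψ x⁻¹ := by
    intro ψ hψ
    simp only [hF, sub_mul, Finset.sum_sub_distrib, ite_mul, zero_mul, ← Finset.sum_filter,
      ← Finset.mul_sum, Irr.sum_filter_isConj_inv hψ]
  have hFχ : ∀ ψ ∈ Irr G, ψ ≠ χ → ∑ x, F x * ψ x⁻¹ = 0 := by
    intro ψ hψ hne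
    rw [hFsum ψ hψ]
    by_cases hi : ψ ∈ inflatedIrr (Subgroup.center G)
    · rw [h.apply_inv_eq_apply_one hψ hne hi,
        sum_filter_mem_eq _ ((Irr.mem_inflatedIrr_iff hψ _).1 hi)]
      ring
    · rw [h.apply_inv_eq_zero hψ hne hi, Irr.sum_filter_mem_center_eq_zero hψ hi _ le_rfl]
      ring
  -- The Fourier coefficient of `F` at χ, the only one that can be nonzero.
  set t : ℂ := (∑ x, F x * χ x⁻¹) / Nat.card G with ht
  have hG : (Nat.card G : ℂ) ≠ 0 := by exact_mod_cast Nat.card_pos.ne'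
  have hzero : (fun x => F x - t * χ x) = 0 := by
    refine eq_zero_of_forall_sum_mul_Irr_eq_zero (fun x k => ?_) fun ψ hψ => ?_
    · simp only [hF, isConj_conj_iff, Subgroup.Normal.mem_conj_iff (N := Subgroup.center G)
        inferInstance, Irr.apply_conj hχ]
    · simp only [sub_mul, Finset.sum_sub_distrib, mul_assoc, ← Finset.mul_sum]
      by_cases hne : ψ = χ
      · rw [hne, Irr.sum_mul_inv_self hχ, ht, div_mul_cancel₀ _ hG, sub_self]
      · rw [hFχ ψ hψ hne, Irr.sum_mul_inv_of_ne hχ hψ (Ne.symm hne), mul_zero, sub_zero]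
  have hFt : ∀ x, F x = t * χ x := fun x => sub_eq_zero.1 (congrFun hzero x)
  have hgF : F g = Nat.card (Subgroup.center G) := by
    simp only [hF, if_pos (IsConj.refl g), if_neg h.1, sub_zero]
  have hgt : t * χ g ≠ 0 := by
    rw [← hFt, hgF]
    exact_mod_cast Nat.card_pos.ne'
  refine ⟨h.1, right_ne_zero_of_mul hgt, fun x hx hgx => ?_⟩
  have hx0 : F x = 0 := by simp only [hF, if_neg hx, if_neg hgx, sub_zero]
  rw [hFt] at hx0
  exact (mul_eq_zero.1 hx0).resolve_left (left_ne_zero_of_mul hgt)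

/-- The integers `χ(1)` and `-χ(g)`, with the values of the two norm and orthogonality relations. -/
theorem VanishesOnNoncentralExcept.exists_nat (h : VanishesOnNoncentralExcept χ g)
    (hχ : χ ∈ Irr G) (h1 : χ 1 ≠ 1) : ∃ d m : ℕ, 0 < d ∧ 0 < m ∧ χ 1 = d ∧ χ g = -(m : ℂ) ∧
      Nat.card (conjugatesOf g) * m = Nat.card (Subgroup.center G) * d ∧
      Nat.card (Subgroup.center G) * d ^ 2 + Nat.card (conjugatesOf g) * m ^ 2 = Nat.card G := by
  classical
  have := Fintype.ofFinite G
  obtain ⟨d, hd, hχ1⟩ := Irr.exists_apply_one_eq hχ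
  have hk := natCard_conjugatesOf_pos g
  have hz : 0 < Nat.card (Subgroup.center G) := Nat.card_pos
  -- χ(g) = −q is rational and an algebraic integer, hence an integer.
  set q : ℚ := Nat.card (Subgroup.center G) * d / Nat.card (conjugatesOf g) with hq
  have hq0 : 0 < q := by positivity
  have hχq : χ g = algebraMap ℚ ℂ (-q) := by
    rw [h.apply_eq hχ h1, hχ1, hq]
    simp
  have hint : IsIntegral ℤ (-q) := by
    have := Irr.isIntegral_apply hχ g
    rw [hχq] at this
    exact (isIntegral_algebraMap_iff (algebraMap ℚ ℂ).injective).1 this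
  obtain ⟨n, hn⟩ := IsIntegrallyClosed.isIntegral_iff.1 hint
  have hn0 : n < 0 := by
    have : (n : ℚ) < 0 := by
      rw [← eq_intCast (algebraMap ℤ ℚ), hn]
      linarith
    exact_mod_cast this
  obtain ⟨m, rfl⟩ : ∃ m : ℕ, n = -(m : ℤ) := ⟨n.natAbs, by omega⟩
  have hχm : χ g = -(m : ℂ) := by
    rw [hχq, ← hn]
    simp
  have hrel : Nat.card (conjugatesOf g) * m = Nat.card (Subgroup.center G) * d := by
    have := h.card_mul_add_card_mul hχ h1
    rw [hχ1, hχm] at this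
    have : (Nat.card (conjugatesOf g) : ℂ) * m = Nat.card (Subgroup.center G) * d := by
      linear_combination -this
    exact_mod_cast this
  refine ⟨d, m, hd, by omega, hχ1, hχm, hrel, ?_⟩
  have hs := h.sum_mul_inv hχ hχ
  rw [Irr.sum_mul_inv_self hχ, sum_filter_mem_eq _ (h.center_subset_charKer hχ),
    Irr.apply_inv hχ, hχm, hχ1, map_neg, Complex.conj_natCast] at hs
  have : (Nat.card (Subgroup.center G) * d ^ 2 + Nat.card (conjugatesOf g) * m ^ 2 : ℂ) =
      Nat.card G := by
    linear_combination -hs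
  exact_mod_cast this

/-- A noncentral element of the kernel would be conjugate to g, where χ is negative. -/
theorem VanishesOnNoncentralExcept.center_eq_charKer (h : VanishesOnNoncentralExcept χ g)
    (hχ : χ ∈ Irr G) (h1 : χ 1 ≠ 1) : (Subgroup.center G : Set G) = charKer χ := by
  refine (h.center_subset_charKer hχ).antisymm fun x hx => ?_
  by_contra hxZ
  obtain ⟨d, m, hd, hm, hχ1, hχm, -⟩ := h.exists_nat hχ h1
  have hgx : IsConj g x := by
    by_contra hn
    exact Irr.apply_one_ne_zero hχ (hx.symm.trans (h.2.2 x hxZ hn))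
  have h2 : (d : ℂ) = -(m : ℂ) := by
    rw [← hχ1, ← hχm, Irr.apply_eq_of_isConj hχ hgx]
    exact hx.symm
  have h3 : ((d + m : ℕ) : ℂ) = 0 := by
    push_cast
    rw [h2, neg_add_cancel]
  have := Nat.cast_eq_zero.1 h3
  omega

/-- Linear characters never vanish, so all of them are trivial on Z and at g. As they detect
everything outside G', both Z and the noncentral g lie in G'. -/
theorem OthersTrivialOrVanishAt.center_lt_commutator (h : OthersTrivialOrVanishAt χ g)
    (h1 : χ 1 ≠ 1) : Subgroup.center G < commutator G := by
  have hne : ∀ f : G →* ℂˣ, (fun x => (f x : ℂ)) ≠ χ := fun f e => h1 (by simp [← e])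
  have hi : ∀ f : G →* ℂˣ, (fun x => (f x : ℂ)) ∈ inflatedIrr (Subgroup.center G) := by
    intro f
    by_contra hi
    exact (f g).ne_zero ((h.2 _ (coe_monoidHom_mem_Irr f) (hne f)).2 hi)
  refine lt_of_le_of_ne (fun x hx => ?_) fun e => h.1 ?_
  · by_contra hxc
    obtain ⟨f, hf⟩ := exists_monoidHom_apply_ne_one_of_notMem_commutator hxc
    have := (Irr.mem_inflatedIrr_iff (coe_monoidHom_mem_Irr f) _).1 (hi f) hx
    exact hf (by simpa [charKer] using this)
  · rw [e]
    by_contra hgc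
    obtain ⟨f, hf⟩ := exists_monoidHom_apply_ne_one_of_notMem_commutator hgc
    have := (h.2 _ (coe_monoidHom_mem_Irr f) (hne f)).1 (hi f)
    exact hf (by simpa [charKer] using this)

/-- `Z(G) ∪ g ^ G` is a normal subgroup. -/
theorem VanishesOnNoncentralExcept.exists_subgroup (h : VanishesOnNoncentralExcept χ g)
    (hχ : χ ∈ Irr G) (h1 : χ 1 ≠ 1) : ∃ M : Subgroup G, M.Normal ∧
      ∀ x, x ∈ M ↔ x ∈ Subgroup.center G ∨ IsConj g x := by
  classical
  have := Fintype.ofFinite G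
  have ho := h.othersTrivialOrVanishAt hχ h1
  choose! K hKn hK hKmul using fun ψ (hψ : ψ ∈ Irr G) => Irr.exists_subgroup_eq_charKer hψ
  set I : Set (G → ℂ) := {ψ | ψ ∈ Irr G ∧ ψ ≠ χ ∧ ψ ∈ inflatedIrr (Subgroup.center G)} with hI
  -- The common kernel of the characters of G/Z other than χ; it contains Z and g.
  set M : Subgroup G := ⨅ ψ : I, K ψ with hM
  have hMmem : ∀ x, x ∈ M ↔ ∀ ψ ∈ I, x ∈ charKer ψ := by
    intro x
    rw [hM, Subgroup.mem_iInf, Subtype.forall]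
    refine forall₂_congr fun ψ hψ => ?_
    rw [← hK ψ hψ.1]
    rfl
  have hMn : M.Normal := by
    refine ⟨fun x hx k => (hMmem _).2 fun ψ hψ => ?_⟩
    have := (hMmem x).1 hx ψ hψ
    exact (Irr.apply_conj hψ.1 x k).trans this
  have hZM : Subgroup.center G ≤ M := fun x hx => (hMmem x).2 fun ψ hψ =>
    (Irr.mem_inflatedIrr_iff hψ.1 _).1 hψ.2.2 hx
  have hgM : g ∈ M := (hMmem g).2 fun ψ hψ => (ho.2 ψ hψ.1 hψ.2.1).1 hψ.2.2
  have hcM : ∀ x, x ∈ Subgroup.center G ∨ IsConj g x → x ∈ M := by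
    rintro x (hx | hx)
    · exact hZM hx
    · obtain ⟨k, rfl⟩ := isConj_iff.1 hx
      exact hMn.conj_mem _ hgM k
  refine ⟨M, hMn, fun x => ⟨fun hx => ?_, hcM x⟩⟩
  by_contra hn
  rw [not_or] at hn
  set z : ℂ := (Nat.card (Subgroup.center G) : ℂ) with hz
  set k : ℂ := (Nat.card (conjugatesOf g) : ℂ) with hk
  -- This `F` is orthogonal to every irreducible character, so it vanishes; at a point of M outside
  -- Z ∪ g^G its value would be |Z| + |g^G| > 0.
  set F : G → ℂ := fun x => (if x ∈ M then z + k else 0) -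
    ((if x ∈ Subgroup.center G then (Nat.card M : ℂ) else 0) +
      (if IsConj g x then (Nat.card M : ℂ) else 0)) with hF
  have hF0 : F = 0 := by
    refine eq_zero_of_forall_sum_mul_Irr_eq_zero (fun x k => ?_) fun ψ hψ => ?_
    · simp only [hF, isConj_conj_iff, hMn.mem_conj_iff,
        Subgroup.Normal.mem_conj_iff (N := Subgroup.center G) inferInstance]
    · simp only [hF, sub_mul, add_mul, Finset.sum_sub_distrib, Finset.sum_add_distrib, ite_mul,
        zero_mul, ← Finset.sum_filter, ← Finset.mul_sum, Irr.sum_filter_isConj_inv hψ]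
      simp only [← add_mul]
      by_cases hne : ψ = χ
      · subst hne
        rw [sum_eq_sum_center_add_sum_isConj h.1 _ {x | x ∈ M} (by simpa using hcM),
          Irr.sum_filter_isConj_inv hψ, sum_filter_mem_eq _ (h.center_subset_charKer hψ)]
        · obtain ⟨d, m, -, -, -, hχm, -⟩ := h.exists_nat hψ h1
          -- The value at g is an integer, hence real.
          have hgi : ψ g⁻¹ = ψ g := by
            rw [Irr.apply_inv hψ, hχm, map_neg, Complex.conj_natCast]
          rw [hgi]
          linear_combination (z + k - Nat.card M) * h.card_mul_add_card_mul hψ h1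
        · intro y hy hgy
          rw [Irr.apply_inv hψ, h.2.2 y hy hgy, map_zero]
      · by_cases hi : ψ ∈ inflatedIrr (Subgroup.center G)
        · rw [ho.apply_inv_eq_apply_one hψ hne hi,
            sum_filter_mem_eq _ ((Irr.mem_inflatedIrr_iff hψ _).1 hi),
            sum_filter_mem_eq M fun y hy => (hMmem y).1 hy ψ ⟨hψ, hne, hi⟩]
          ring
        · rw [ho.apply_inv_eq_zero hψ hne hi, Irr.sum_filter_mem_center_eq_zero hψ hi _ le_rfl,
            Irr.sum_filter_mem_center_eq_zero hψ hi _ hZM]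
          ring
  have hx0 : F x = 0 := congrFun hF0 x
  simp only [hF, if_pos hx, if_neg hn.1, if_neg hn.2, add_zero, sub_zero, hz, hk] at hx0
  have h3 : Nat.card (Subgroup.center G) + Nat.card (conjugatesOf g) = 0 := by exact_mod_cast hx0
  have := natCard_conjugatesOf_pos g
  omega

end VanishesOnNoncentralExcept

/-! ### Divisibility of degrees and passage to G/Z. -/

/-- The space of R-invariants has dimension |R|⁻¹ times the sum of φ over R, which here is φ(1)/|R|.
-/
theorem Irr.natCard_dvd_of_forall_eq_zero {H : Type*} [Group H] [Finite H] {φ : H → ℂ}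
    (hφ : φ ∈ Irr H) (R : Subgroup H) (h : ∀ x ∈ R, x ≠ 1 → φ x = 0) {d : ℕ} (hd : φ 1 = d) :
    Nat.card R ∣ d := by
  obtain ⟨n, ρ, hρ, rfl⟩ := hφ
  have := Fintype.ofFinite R
  have hR : (Nat.card R : ℂ) ≠ 0 := by exact_mod_cast Nat.card_pos.ne'
  let _ : Invertible (Nat.card R : ℂ) := invertibleOfNonzero hR
  let σ : Representation ℂ R (Fin n → ℂ) := ρ.comp R.subtype
  have hσ : ∀ x : R, σ.character x = ρ.character x := fun _ => rfl
  have hs := σ.card_inv_mul_sum_char_eq_finrank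
  rw [Fintype.sum_eq_single 1 fun x hx => by
      rw [hσ]; exact h x x.2 fun e => hx (Subtype.ext e),
    hσ, inv_mul_eq_iff_eq_mul₀ hR] at hs
  exact ⟨_, by exact_mod_cast hd.symm.trans hs⟩

theorem natCard_conjugatesOf_mul_natCard_centralizer {G : Type*} [Group G] (g : G) :
    Nat.card (conjugatesOf g) * Nat.card (Subgroup.centralizer {g}) = Nat.card G := by
  have : conjugatesOf g = MulAction.orbit (ConjAct G) g := by
    ext x
    rw [show x ∈ conjugatesOf g ↔ IsConj g x from Iff.rfl, ConjAct.mem_orbit_conjAct, isConj_comm]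
  rw [Subgroup.nat_card_centralizer_nat_card_stabilizer, this, Nat.card_coe_set_eq,
    ← MulAction.index_stabilizer, Subgroup.index_mul_card]
  rfl

section Quotient

variable {G : Type*} [Group G] {χ : G → ℂ} {g : G}

/-- As g is conjugate to all of gZ, its class is the full preimage of the class of gZ. -/
theorem VanishesOnNoncentralExcept.isConj_mk_iff (h : VanishesOnNoncentralExcept χ g)
    (hχ : χ ∈ Irr G) (x : G) :
    IsConj (g : G ⧸ Subgroup.center G) (x : G ⧸ Subgroup.center G) ↔ IsConj g x := by
  refine ⟨fun hc => ?_, fun hc => (QuotientGroup.mk' (Subgroup.center G)).map_isConj hc⟩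
  obtain ⟨c, hc⟩ := isConj_iff.1 hc
  obtain ⟨c, rfl⟩ := QuotientGroup.mk_surjective c
  rw [← QuotientGroup.mk_mul, ← QuotientGroup.mk_inv, ← QuotientGroup.mk_mul,
    QuotientGroup.eq] at hc
  have h1 := h.isConj_mul hχ hc
  have hz := Subgroup.mem_center_iff.1 hc
  refine h1.trans (isConj_iff.2 ⟨c, ?_⟩)
  rw [← hz g, mul_assoc, mul_assoc, ← hz c⁻¹]
  group

theorem VanishesOnNoncentralExcept.natCard_conjugatesOf (h : VanishesOnNoncentralExcept χ g)
    (hχ : χ ∈ Irr G) : Nat.card (conjugatesOf g) = Nat.card (Subgroup.center G) *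
      Nat.card (conjugatesOf (g : G ⧸ Subgroup.center G)) := by
  rw [← QuotientGroup.card_preimage_mk]
  congr 2
  ext x
  exact (h.isConj_mk_iff hχ x).symm

variable [Finite G]

/-- Passing to G/Z divides both the group order and the class size by |Z|. -/
theorem VanishesOnNoncentralExcept.natCard_centralizer (h : VanishesOnNoncentralExcept χ g)
    (hχ : χ ∈ Irr G) : Nat.card (Subgroup.centralizer {g}) =
      Nat.card (Subgroup.centralizer {(g : G ⧸ Subgroup.center G)}) := by
  have h1 := natCard_conjugatesOf_mul_natCard_centralizer g
  have h2 := natCard_conjugatesOf_mul_natCard_centralizer (g : G ⧸ Subgroup.center G)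
  rw [Subgroup.card_eq_card_quotient_mul_card_subgroup (Subgroup.center G), ← h2,
    h.natCard_conjugatesOf hχ] at h1
  have hz : 0 < Nat.card (Subgroup.center G) := Nat.card_pos
  have hk := natCard_conjugatesOf_pos (g : G ⧸ Subgroup.center G)
  refine Nat.eq_of_mul_eq_mul_left (Nat.mul_pos hz hk) (h1.trans ?_)
  ring

end Quotient

/-- If the nontrivial elements of a normal subgroup form a single conjugacy class, then it is
a `p`-group for some prime `p`. -/
theorem exists_prime_forall_pow_eq_one {H : Type*} [Group H] [Finite H] {N : Subgroup H} {y : H}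
    (hy : y ≠ 1) (hN : ∀ x, x ∈ N ↔ x = 1 ∨ IsConj y x) :
    ∃ p : ℕ, p.Prime ∧ ∀ x ∈ N, x ^ p = 1 := by
  have ho : orderOf y ≠ 1 := fun h => hy (orderOf_eq_one_iff.1 h)
  have hp := Nat.minFac_prime ho
  set p := (orderOf y).minFac with hpdef
  have hdvd : p ∣ orderOf y := Nat.minFac_dvd _
  have hord : orderOf (y ^ (orderOf y / p)) = p :=
    orderOf_pow_orderOf_div (orderOf_pos y).ne' hdvd
  have hyN : y ∈ N := (hN y).2 (Or.inr (IsConj.refl y))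
  have hconj : ∀ {x}, IsConj y x → ∀ n : ℕ, y ^ n = 1 ↔ x ^ n = 1 := by
    intro x hx n
    obtain ⟨c, rfl⟩ := isConj_iff.1 hx
    rw [conj_pow, conj_eq_one_iff]
  -- A power of `y` of order p is a nontrivial element of N, hence conjugate to `y`.
  have hyp : y ^ p = 1 := by
    rcases (hN _).1 (pow_mem hyN (orderOf y / p)) with h | h
    · rw [h, orderOf_one] at hord
      exact absurd hord.symm hp.ne_one
    · rw [hconj h]
      exact orderOf_dvd_iff_pow_eq_one.1 (dvd_of_eq hord)
  refine ⟨p, hp, fun x hx => ?_⟩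
  rcases (hN x).1 hx with rfl | hx
  · exact one_pow p
  · exact (hconj hx p).1 hyp

theorem natCard_eq_natCard_conjugatesOf_add_one {H : Type*} [Group H] [Finite H] {N : Subgroup H}
    {y : H} (hy : y ≠ 1) (hN : ∀ x, x ∈ N ↔ x = 1 ∨ IsConj y x) :
    Nat.card N = Nat.card (conjugatesOf y) + 1 := by
  have h1 : (N : Set H) = insert 1 (conjugatesOf y) := by
    ext x
    exact hN x
  have h2 : (1 : H) ∉ conjugatesOf y := fun h => hy (isConj_one_right.1 (IsConj.symm (a := y) h))
  rw [← SetLike.coe_sort_coe, h1, Nat.card_coe_set_eq, Nat.card_coe_set_eq,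
    Set.ncard_insert_of_notMem h2]

theorem VanishesOnNoncentralExcept.mem_map_mk_iff {G : Type*} [Group G] {χ : G → ℂ} {g : G}
    (h : VanishesOnNoncentralExcept χ g) (hχ : χ ∈ Irr G) {M : Subgroup G}
    (hM : ∀ x, x ∈ M ↔ x ∈ Subgroup.center G ∨ IsConj g x) (y : G ⧸ Subgroup.center G) :
    y ∈ M.map (QuotientGroup.mk' (Subgroup.center G)) ↔
      y = 1 ∨ IsConj (g : G ⧸ Subgroup.center G) y := by
  obtain ⟨x, rfl⟩ := QuotientGroup.mk_surjective y
  rw [h.isConj_mk_iff hχ, QuotientGroup.eq_one_iff, ← hM, ← QuotientGroup.mk'_apply,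
    ← Subgroup.mem_comap, Subgroup.comap_map_eq_self]
  rw [QuotientGroup.ker_mk']
  exact fun x hx => (hM x).2 (Or.inl hx)

/-- If `φ` vanishes outside a subgroup of exponent `p`, and `φ(1) * m` divides the group order,
then `p` is the only possible prime divisor of `m`. -/
theorem Irr.not_dvd_of_vanishes_outside {H : Type*} [Group H] [Finite H] {φ : H → ℂ}
    (hφ : φ ∈ Irr H) {N : Subgroup H} (hv : ∀ x, x ∉ N → φ x = 0) {p : ℕ} (hp : p.Prime)
    (hN : ∀ x ∈ N, x ^ p = 1) {d m : ℕ} (hd : φ 1 = d) (hdm : d * m ∣ Nat.card H)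
    {r : ℕ} (hr : r.Prime) (hrp : r ≠ p) : ¬ r ∣ m := by
  intro hrm
  have := Fact.mk hr
  have R : Sylow r H := default
  have hRd : Nat.card R ∣ d := by
    -- Elements of R have r-power order and those of N have order dividing p, so R ∩ N = 1.
    refine Irr.natCard_dvd_of_forall_eq_zero hφ R (fun x hx hx1 => hv x fun hxN => hx1 ?_) hd
    obtain ⟨k, hk⟩ := IsPGroup.iff_orderOf.1 R.isPGroup' ⟨x, hx⟩
    rw [Subgroup.orderOf_mk] at hk
    have hxp : orderOf x ∣ p := orderOf_dvd_of_pow_eq_one (hN x hxN)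
    rcases (Nat.dvd_prime hp).1 hxp with h1 | h1
    · exact orderOf_eq_one_iff.1 h1
    · rw [h1] at hk
      exact absurd ((Nat.prime_dvd_prime_iff_eq hp hr).1
        (hp.dvd_of_dvd_pow (dvd_of_eq hk))).symm hrp
  -- If r divided m, then r|R| would divide dm, exceeding the r-part of |H|.
  have hpow : r ^ ((Nat.card H).factorization r + 1) ∣ Nat.card H := by
    refine dvd_trans ?_ hdm
    rw [pow_succ, ← R.card_eq_multiplicity]
    exact mul_dvd_mul hRd hrm
  exact Nat.pow_succ_factorization_not_dvd Nat.card_pos.ne' hr hpow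

/-! ### The prime p and the unique minimal normal subgroup of G/Z. -/

section Conclusion

variable {G : Type*} [Group G] [Finite G] {χ : G → ℂ} {g : G}

theorem VanishesOnNoncentralExcept.exists_prime_natCard_centralizer
    (h : VanishesOnNoncentralExcept χ g) (hχ : χ ∈ Irr G) (h1 : χ 1 ≠ 1) :
    ∃ p : ℕ, p.Prime ∧ (∃ k : ℕ, Nat.card (Subgroup.centralizer {g}) = p ^ k) ∧
        IsPGroup p (Subgroup.center G) := by
  obtain ⟨M, hMn, hM⟩ := h.exists_subgroup hχ h1
  obtain ⟨d, m, hd, hm, hχ1, hχm, hrel, hnorm⟩ := h.exists_nat hχ h1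
  have hN := h.mem_map_mk_iff hχ hM
  set N := M.map (QuotientGroup.mk' (Subgroup.center G)) with hNdef
  have hy : (g : G ⧸ Subgroup.center G) ≠ 1 := fun e => h.1 ((QuotientGroup.eq_one_iff g).1 e)
  obtain ⟨p, hp, hNp⟩ := exists_prime_forall_pow_eq_one hy hN
  have hNcard := natCard_eq_natCard_conjugatesOf_add_one hy hN
  have hcent := h.natCard_centralizer hχ
  have hcl := natCard_conjugatesOf_mul_natCard_centralizer (g : G ⧸ Subgroup.center G)
  have hcg := h.natCard_conjugatesOf hχ
  have hZ : 0 < Nat.card (Subgroup.center G) := Nat.card_pos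
  have hk := natCard_conjugatesOf_pos (g : G ⧸ Subgroup.center G)
  rw [← hcent] at hcl
  rw [hcg] at hrel hnorm
  rw [Subgroup.card_eq_card_quotient_mul_card_subgroup (Subgroup.center G)] at hnorm
  set k := Nat.card (conjugatesOf (g : G ⧸ Subgroup.center G))
  set z := Nat.card (Subgroup.center G)
  set c := Nat.card (Subgroup.centralizer {g})
  set n := Nat.card (G ⧸ Subgroup.center G) with hn
  -- Here `k` is the class size of gZ, so `k + 1` is the order of M/Z. Orthogonality to the trivial
  -- character, the norm of χ, and orbit-stabilizer give the three formulas in turn.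
  have hdk : d = k * m := Nat.eq_of_mul_eq_mul_left hZ (by rw [← hrel, mul_assoc])
  have hnd : n = d * m * (k + 1) := Nat.eq_of_mul_eq_mul_left hZ (by
    rw [mul_comm, ← hnorm, hdk]
    ring)
  have hc : c = m ^ 2 * (k + 1) := Nat.eq_of_mul_eq_mul_left hk (by
    rw [hcl, hnd, hdk]
    ring)
  obtain ⟨φ, hφ, hχφ⟩ := (Irr.mem_inflatedIrr_iff hχ _).2 (h.center_subset_charKer hχ)
  have hv : ∀ x, x ∉ N → φ x = 0 := by
    intro x hx
    rw [hN, not_or] at hx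
    obtain ⟨x, rfl⟩ := QuotientGroup.mk_surjective x
    rw [h.isConj_mk_iff hχ, QuotientGroup.eq_one_iff] at hx
    exact (congrFun hχφ x).symm.trans (h.2.2 x hx.1 hx.2)
  have hφ1 : φ 1 = d := by
    rw [← hχ1, hχφ]
    rfl
  -- The formula for |G/Z| shows that dm divides it, so p is the only possible prime divisor of m.
  have hmp := Nat.eq_prime_pow_of_unique_prime_dvd hm.ne' fun {r} hr hrm => by
    by_contra hrp
    exact Irr.not_dvd_of_vanishes_outside hφ hv hp hNp hφ1 (hn ▸ hnd ▸ dvd_mul_right _ _) hr hrp hrm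
  have := Fact.mk hp
  have hNP : IsPGroup p N := fun x => ⟨1, by
    rw [pow_one]
    exact Subtype.ext (hNp x x.2)⟩
  obtain ⟨a, ha⟩ := IsPGroup.iff_card.1 hNP
  rw [hNcard] at ha
  have hcp : c = p ^ (m.primeFactorsList.length * 2 + a) := by
    rw [hc, ha, pow_add, pow_mul, ← hmp]
  refine ⟨p, hp, ⟨_, hcp⟩, ?_⟩
  exact (IsPGroup.of_card hcp).to_le (Subgroup.center_le_centralizer {g})

/-- Every nontrivial normal K of G/Z contains gZ, hence M/Z. Otherwise some ψ trivial on the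
preimage of K is nontrivial at g; by (2) it must be χ, but ker χ = Z forces K = 1. -/
theorem VanishesOnNoncentralExcept.isUniqueMinimalNormal
    (h : VanishesOnNoncentralExcept χ g) (hχ : χ ∈ Irr G) (h1 : χ 1 ≠ 1) {M : Subgroup G}
    (hMn : M.Normal) (hM : ∀ x, x ∈ M ↔ x ∈ Subgroup.center G ∨ IsConj g x) :
    IsUniqueMinimalNormal (M.map (QuotientGroup.mk' (Subgroup.center G))) := by
  have hN := h.mem_map_mk_iff hχ hM
  have hNn : (M.map (QuotientGroup.mk' (Subgroup.center G))).Normal :=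
    hMn.map _ (QuotientGroup.mk'_surjective _)
  set N := M.map (QuotientGroup.mk' (Subgroup.center G)) with hNdef
  have hy : (g : G ⧸ Subgroup.center G) ≠ 1 := fun e => h.1 ((QuotientGroup.eq_one_iff g).1 e)
  have hNbot : N ≠ ⊥ := fun e => hy (by
    have : (g : G ⧸ Subgroup.center G) ∈ N := (hN _).2 (Or.inr (IsConj.refl _))
    rwa [e, Subgroup.mem_bot] at this)
  have hle : ∀ K : Subgroup (G ⧸ Subgroup.center G), K.Normal → K ≠ ⊥ → N ≤ K := by
    intro K hK hKbot
    have hgK : (g : G ⧸ Subgroup.center G) ∈ K := by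
      by_contra hgK
      let L := K.comap (QuotientGroup.mk' (Subgroup.center G))
      obtain ⟨ψ, hψ, hLψ, hgψ⟩ := exists_mem_Irr_subset_charKer_apply_ne L (x := g) hgK
      have hZL : Subgroup.center G ≤ L := fun x hx => by
        rw [Subgroup.mem_comap, QuotientGroup.mk'_apply, (QuotientGroup.eq_one_iff x).2 hx]
        exact one_mem K
      by_cases hne : ψ = χ
      · rw [hne, ← h.center_eq_charKer hχ h1] at hLψ
        refine hKbot ((Subgroup.eq_bot_iff_forall K).2 fun y hyK => ?_)
        obtain ⟨x, rfl⟩ := QuotientGroup.mk_surjective y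
        exact (QuotientGroup.eq_one_iff x).2 (hLψ hyK)
      · exact hgψ (((h.othersTrivialOrVanishAt hχ h1).2 ψ hψ hne).1
          ((Irr.mem_inflatedIrr_iff hψ _).2 fun x hx => hLψ (hZL hx)))
    intro y hyN
    rcases (hN y).1 hyN with rfl | hyc
    · exact one_mem K
    · obtain ⟨c, rfl⟩ := isConj_iff.1 hyc
      exact hK.conj_mem _ hgK c
  exact ⟨⟨⟨hNn, hNbot⟩, fun K hK _ => hle K hK.1 hK.2⟩, fun K hK =>
    le_antisymm (hK.2 ⟨hNn, hNbot⟩ (hle K hK.1.1 hK.1.2)) (hle K hK.1.1 hK.1.2)⟩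

end Conclusion

theorem theorem1p6 {G : Type*} [Group G] [Finite G] (χ : G → ℂ) (hχ : χ ∈ Irr G)
    (hnonlinear : χ 1 ≠ 1) :
    ((∃ g : G, VanishesOnNoncentralExcept χ g) ↔
      ((Subgroup.center G : Set G) ⊆ charKer χ ∧ ∃ g : G, OthersTrivialOrVanishAt χ g)) ∧
    ∀ g : G,
      (VanishesOnNoncentralExcept χ g ∨
        ((Subgroup.center G : Set G) ⊆ charKer χ ∧ OthersTrivialOrVanishAt χ g)) →
      (Subgroup.center G : Set G) = charKer χ ∧
      Subgroup.center G < commutator G ∧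
      χ g = -((Nat.card (Subgroup.center G) : ℂ) * χ 1 / (Nat.card (conjugatesOf g) : ℂ)) ∧
      (∃ n : ℤ, χ g = (n : ℂ)) ∧
      Nat.card (Subgroup.centralizer {g}) =
        Nat.card (Subgroup.centralizer {(g : G ⧸ Subgroup.center G)}) ∧
      (∃ p : ℕ, p.Prime ∧ (∃ k : ℕ, Nat.card (Subgroup.centralizer {g}) = p ^ k) ∧
        IsPGroup p (Subgroup.center G)) ∧
      ∃ M : Subgroup G, Subgroup.center G ≤ M ∧
        IsUniqueMinimalNormal (M.map (QuotientGroup.mk' (Subgroup.center G))) ∧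
        ∃ c : ConjClasses G, c.carrier = (M : Set G) \ (Subgroup.center G : Set G) := by
  refine ⟨⟨?_, ?_⟩, fun g hg => ?_⟩
  · rintro ⟨g, h⟩
    exact ⟨h.center_subset_charKer hχ, g, h.othersTrivialOrVanishAt hχ hnonlinear⟩
  · rintro ⟨-, g, h⟩
    exact ⟨g, h.vanishesOnNoncentralExcept hχ⟩
  · have h : VanishesOnNoncentralExcept χ g :=
      hg.elim id fun h => h.2.vanishesOnNoncentralExcept hχ
    obtain ⟨d, m, -, -, -, hχm, -⟩ := h.exists_nat hχ hnonlinear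
    obtain ⟨M, hMn, hM⟩ := h.exists_subgroup hχ hnonlinear
    refine ⟨h.center_eq_charKer hχ hnonlinear,
      (h.othersTrivialOrVanishAt hχ hnonlinear).center_lt_commutator hnonlinear,
      h.apply_eq hχ hnonlinear, ⟨-(m : ℤ), by simpa using hχm⟩, h.natCard_centralizer hχ,
      h.exists_prime_natCard_centralizer hχ hnonlinear, M, fun x hx => (hM x).2 (Or.inl hx),
      h.isUniqueMinimalNormal hχ hnonlinear hMn hM, ConjClasses.mk g, ?_⟩
    ext x
    rw [ConjClasses.mem_carrier_iff_mk_eq, ConjClasses.mk_eq_mk_iff_isConj, Set.mem_sdiff,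
      SetLike.mem_coe, SetLike.mem_coe, hM, isConj_comm]
    refine ⟨fun hx => ⟨Or.inr hx, fun hxZ => h.1 ?_⟩, fun hx => hx.1.resolve_left hx.2⟩
    obtain ⟨c, rfl⟩ := isConj_iff.1 hx
    exact (Subgroup.Normal.mem_conj_iff inferInstance).1 hxZ
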